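/- Let $(M,g)$ be a smooth finite-dimensional Riemannian manifold without boundary, $K$ a compact Lie group with Lie algebra $\mathfrak k$, $p:P\to M$ a smooth principal $K$-bundle (right action), and $A$ a connection on $P$ with connection form $\omega_A\in A^1(P,\mathfrak k)$, i.e. $\omega_A(a^\#)=a$ for $a\in\mathfrak k$, where $a^\#_y=\frac{d}{dt}\big|_{t=0}\,y\exp(ta)$, and $R_k^*\omega_A=\mathrm{Ad}_{k^{-1}}\omega_A$ for $k\in K$. Fix an $\mathrm{Ad}$-invariant inner product $\langle\!\langle\cdot,\cdot\rangle\!\rangle$ on $\mathfrak k$ and let $g_A=p^*g+\langle\!\langle\omega_A,\omega_A\rangle\!\rangle$ be the connection metric on $P$, that is $$g_A(v,w)=g(p_*v,p_*w)+\langle\!\langle\omega_A(v),\omega_A(w)\rangle\!\rangle,\qquad v,w\in T_yP .$$ For a vector field $Z$ on $M$ let $\tilde Z$ be its horizontal lift, the vector field on $P$ with $p_*\tilde Z_y=Z_{p(y)}$ and $\omega_A(\tilde Z)=0$. Regard smooth sections of the adjoint bundle $\mathrm{ad}(P)=P\times_{\mathrm{Ad}}\mathfrak k$ as smooth maps $\nu:P\to\mathfrak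 k$ with $\nu(yk)=\mathrm{Ad}_{k^{-1}}\nu(y)$; for such $\nu$ let $\xi^\nu$ be the vertical field $\xi^\nu_y=\frac{d}{dt}\big|_{t=0}\,y\exp(t\nu(y))$, and let $\nabla^A_Z\nu=d\nu(\tilde Z)$. Let $F_A\in A^2(\mathrm{ad}(P))$ be the curvature of $A$, $F_A(X,Z)=\Omega_A(\tilde X,\tilde Z)$ with $\Omega_A(U,V)=d\omega_A(U,V)+[\omega_A(U),\omega_A(V)]$ and $d\omega_A(U,V)=U\omega_A(V)-V\omega_A(U)-\omega_A([U,V])$. A vector field $Y$ on a manifold with metric $h$ is called Killing if $L_Yh=0$. Then for every smooth vector field $X$ on $M$ and every smooth section $\nu$ of $\mathrm{ad}(P)$, the vector field $\tilde X+\xi^\nu$ is Killing on $(P,g_A)$ if and only if $X$ is Killing on $(M,g)$ and $\iota_XF_A=-\nabla^A\nu$, i.e. $F_A(X,Z)=-\nabla^A_Z\nu$ for every smooth vector field $Z$ on $M$. -/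

import Mathlib

open Bundle Manifold VectorField MulOpposite
open scoped ContDiff

noncomputable section

namespace ConnectionMetric

variable {EM : Type*} [NormedAddCommGroup EM] [NormedSpace ℝ EM]
  {HM : Type*} [TopologicalSpace HM] (IM : ModelWithCorners ℝ EM HM)
  {M : Type*} [TopologicalSpace M] [ChartedSpace HM M] [IsManifold IM ∞ M]
  {EK : Type*} [NormedAddCommGroup EK] [NormedSpace ℝ EK]
  {HK : Type*} [TopologicalSpace HK] (IK : ModelWithCorners ℝ EK HK)
  {K : Type*} [TopologicalSpace K] [ChartedSpace HK K] [Group K]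
  {EP : Type*} [NormedAddCommGroup EP] [NormedSpace ℝ EP]
  {HP : Type*} [TopologicalSpace HP] (IP : ModelWithCorners ℝ EP HP)
  {P : Type*} [TopologicalSpace P] [ChartedSpace HP P] [IsManifold IP ∞ P]
  [MulAction Kᵐᵒᵖ P]

/-! ### Vector fields, Lie derivative of a field of bilinear forms, Killing fields -/

/-- `X` is a smooth (global) vector field. -/
def IsSmoothField (X : ∀ x : M, TangentSpace IM x) : Prop :=
  ContMDiff IM IM.tangent ∞ (fun x => (⟨x, X x⟩ : TangentBundle IM M))

/-- The Lie derivative `(L_X h)(U, V) = X (h(U, V)) - h([X, U], V) - h(U, [X, V])` of a field of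
bilinear forms `h`, evaluated on vector fields `U`, `V` at the point `x`. -/
def lieDerivBilin (X : ∀ x : M, TangentSpace IM x)
    (h : ∀ x : M, TangentSpace IM x →L[ℝ] TangentSpace IM x →L[ℝ] ℝ)
    (U V : ∀ x : M, TangentSpace IM x) (x : M) : ℝ :=
  mvfderiv IM (fun z => h z (U z) (V z)) x (X x)
    - h x (mlieBracket IM X U x) (V x) - h x (U x) (mlieBracket IM X V x)

/-- `X` is a Killing field of the metric `h`: `L_X h = 0`. -/
def IsKilling (h : ∀ x : M, TangentSpace IM x →L[ℝ] TangentSpace IM x →L[ℝ] ℝ)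
    (X : ∀ x : M, TangentSpace IM x) : Prop :=
  ∀ U V : ∀ x : M, TangentSpace IM x, IsSmoothField IM U → IsSmoothField IM V →
    ∀ x : M, lieDerivBilin IM X h U V x = 0

/-! ### The structure group -/

/-- The adjoint representation: `Ad k` is the derivative at `1` of the conjugation
`h ↦ k * h * k⁻¹`. (The tangent spaces at `k * 1 * k⁻¹` and at `1` are the same.) -/
def Ad (k : K) : GroupLieAlgebra IK K →L[ℝ] GroupLieAlgebra IK K :=
  (mfderiv IK IK (fun h : K => k * h * k⁻¹) 1 : EK →L[ℝ] EK)

variable (K) in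
/-- An `Ad`-invariant inner product on the Lie algebra of `K`. -/
structure AdInvariantInner where
  inner : GroupLieAlgebra IK K →L[ℝ] GroupLieAlgebra IK K →L[ℝ] ℝ
  symm (a b : GroupLieAlgebra IK K) : inner a b = inner b a
  pos (a : GroupLieAlgebra IK K) (ha : a ≠ 0) : 0 < inner a a
  invariant (k : K) (a b : GroupLieAlgebra IK K) : inner (Ad IK k a) (Ad IK k b) = inner a b

/-! ### Principal bundles

The right action of `K` on `P` is an action of the opposite group: `y k` is `op k • y`. -/

variable (K) in
/-- `p : P → M` is a smooth principal `K`-bundle: the right action of `K` on `P` is smooth and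
preserves the fibres of the smooth map `p`, and each point of `M` has an open
neighbourhood `U` with a `K`-equivariant diffeomorphism `p⁻¹(U) ≃ U × K` over `U`. -/
structure IsPrincipalBundle (p : P → M) : Prop where
  contMDiff_proj : ContMDiff IP IM ∞ p
  contMDiff_action : ContMDiff (IP.prod IK) IP ∞ (fun q : P × K => op q.2 • q.1)
  proj_action (y : P) (k : K) : p (op k • y) = p y
  exists_trivialization (x : M) : ∃ e : Trivialization K p, x ∈ e.baseSet ∧
    ContMDiffOn IP (IM.prod IK) ∞ e e.source ∧
    ContMDiffOn (IM.prod IK) IP ∞ e.toOpenPartialHomeomorph.symm e.target ∧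
    ∀ y ∈ e.source, ∀ k : K, (e (op k • y)).2 = (e y).2 * k

/-- The value `a^#_y` at `y` of the fundamental field of `a`: the derivative at `1` of the orbit map
`k ↦ y k`, applied to `a`, i.e. the velocity at `t = 0` of `y exp(ta)`. -/
def fundamental (y : P) : GroupLieAlgebra IK K →L[ℝ] TangentSpace IP y :=
  (mfderiv IK IP (fun k : K => op k • y) 1 : EK →L[ℝ] EP)

variable (K P) in
/-- A connection on a principal `K`-bundle with total space `P`, given by its connection form: a
smooth `𝔨`-valued `1`-form `ω` on `P` with `ω(a^#) = a` and `R_k^* ω = Ad(k⁻¹) ω`.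
The horizontal distribution is `ker ω`. -/
structure PrincipalConnection where
  form (y : P) : TangentSpace IP y →L[ℝ] GroupLieAlgebra IK K
  contMDiff_form : ContMDiff IP.tangent 𝓘(ℝ, EK) (M' := EK) ∞
    (fun v : TangentBundle IP P => form v.proj v.snd)
  form_fundamental (y : P) (a : GroupLieAlgebra IK K) : form y (fundamental IK IP y a) = a
  form_equivariant (k : K) (y : P) (v : TangentSpace IP y) :
    form (op k • y) (mfderiv IP IP (fun z : P => op k • z) y v) = Ad IK k⁻¹ (form y v)

variable (K P) in
/-- A smooth section of the adjoint bundle `ad(P) = P ×_Ad 𝔨`, as a smooth `K`-equivariant map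
`ν : P → 𝔨`, i.e. `ν(y k) = Ad(k⁻¹) ν(y)`; the section is `p(y) ↦ [y, ν(y)]`. -/
structure AdSection where
  toFun : P → GroupLieAlgebra IK K
  contMDiff_toFun : ContMDiff IP 𝓘(ℝ, EK) (M' := EK) ∞ toFun
  equivariant (y : P) (k : K) : toFun (op k • y) = Ad IK k⁻¹ (toFun y)

/-- The derivative `df_y(v)` of a map `f : P → 𝔨` with values in the vector space `𝔨`. -/
def dirDeriv (f : P → GroupLieAlgebra IK K) (y : P) (v : TangentSpace IP y) :
    GroupLieAlgebra IK K :=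
  mvfderiv IP (F := EK) f y v

/-- The vertical vector field `ξ^ν` of a map `ν : P → 𝔨`. -/
def verticalField (ν : P → GroupLieAlgebra IK K) (y : P) : TangentSpace IP y :=
  fundamental IK IP y (ν y)

variable {IK IP}

/-- The horizontal lift `T_{p(y)} M → T_y P`: the inverse of `(dp, ω) : T_y P → T_{p(y)} M × 𝔨`
(a linear isomorphism), restricted to `T_{p(y)} M × {0}`. It sends `u` to the unique `v` with
`dp(v) = u` and `ω(v) = 0`. -/
def horizontalLift (A : PrincipalConnection IK K IP P) (p : P → M) (y : P) :
    TangentSpace IM (p y) →L[ℝ] TangentSpace IP y :=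
  ((mfderiv IP IM p y).prod (A.form y)).inverse ∘L
    ContinuousLinearMap.inl ℝ (TangentSpace IM (p y)) (GroupLieAlgebra IK K)

/-- The horizontal lift of a vector field on `M`. -/
def liftField (A : PrincipalConnection IK K IP P) (p : P → M) (X : ∀ x : M, TangentSpace IM x)
    (y : P) : TangentSpace IP y :=
  horizontalLift IM A p y (X (p y))

/-- The exterior derivative of the connection form on vector fields:
`dω(U, V) = U (ω(V)) - V (ω(U)) - ω([U, V])`. -/
def PrincipalConnection.extDerivForm (A : PrincipalConnection IK K IP P)
    (U V : ∀ y : P, TangentSpace IP y) (y : P) : GroupLieAlgebra IK K :=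
  dirDeriv IK IP (fun z => A.form z (V z)) y (U y)
    - dirDeriv IK IP (fun z => A.form z (U z)) y (V y)
    - A.form y (mlieBracket IP U V y)

/-- The curvature form `Ω = dω + ½ [ω ∧ ω]`, that is `Ω(U, V) = dω(U, V) + [ω(U), ω(V)]`. -/
def PrincipalConnection.curvatureForm (A : PrincipalConnection IK K IP P)
    (U V : ∀ y : P, TangentSpace IP y) (y : P) : GroupLieAlgebra IK K :=
  A.extDerivForm U V y + ⁅A.form y (U y), A.form y (V y)⁆

/-- The curvature `F_A ∈ A²(ad P)` on vector fields `X`, `Z` of `M`: the section `F_A(X, Z)` of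
`ad(P)`, as a map `P → 𝔨`. -/
def curvature (A : PrincipalConnection IK K IP P) (p : P → M) (X Z : ∀ x : M, TangentSpace IM x)
    (y : P) : GroupLieAlgebra IK K :=
  A.curvatureForm (liftField IM A p X) (liftField IM A p Z) y

/-- The covariant derivative `∇^A_Z ν` of a section of `ad(P)`, as a map `P → 𝔨`: the derivative of
`ν` along the horizontal lift of `Z`. -/
def covDeriv (A : PrincipalConnection IK K IP P) (p : P → M) (ν : P → GroupLieAlgebra IK K)
    (Z : ∀ x : M, TangentSpace IM x) (y : P) : GroupLieAlgebra IK K :=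
  dirDeriv IK IP ν y (liftField IM A p Z y)

/-- The generalized moment map equation `ι_X F_A = -∇^A ν`, an equality of `ad(P)`-valued `1`-forms
on `M`. -/
def GeneralizedMomentMapEq (A : PrincipalConnection IK K IP P) (p : P → M)
    (X : ∀ x : M, TangentSpace IM x) (ν : P → GroupLieAlgebra IK K) : Prop :=
  ∀ Z : ∀ x : M, TangentSpace IM x, IsSmoothField IM Z →
    ∀ y : P, curvature IM A p X Z y = -covDeriv IM A p ν Z y

/-- The connection metric `g_A = p^* g + ⟪ω_A, ω_A⟫` on `P`. -/
def connectionMetric (A : PrincipalConnection IK K IP P) (p : P → M)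
    (g : ContMDiffRiemannianMetric IM ∞ EM (fun x : M => TangentSpace IM x))
    (B : AdInvariantInner IK K) (y : P) : TangentSpace IP y →L[ℝ] TangentSpace IP y →L[ℝ] ℝ :=
  (ContinuousLinearMap.precomp ℝ (mfderiv IP IM p y)) ∘L g.inner (p y) ∘L mfderiv IP IM p y
    + (ContinuousLinearMap.precomp ℝ (A.form y)) ∘L B.inner ∘L A.form y

theorem connectionMetric_apply (A : PrincipalConnection IK K IP P) (p : P → M)
    (g : ContMDiffRiemannianMetric IM ∞ EM (fun x : M => TangentSpace IM x))
    (B : AdInvariantInner IK K) (y : P) (v w : TangentSpace IP y) :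
    connectionMetric IM A p g B y v w =
      g.inner (p y) (mfderiv IP IM p y v) (mfderiv IP IM p y w)
        + B.inner (A.form y v) (A.form y w) :=
  rfl

end ConnectionMetric

end

open ConnectionMetric

/-!
Write `W = X̃ + ξ^ν`, and `a^#` for the fundamental field of `a ∈ 𝔨`. The Lie derivative `L_W g_A` is
a symmetric tensor (`tensorialAt_lieDerivBilin_left`), and the map `(dp, ω) : T_y P → T_{p(y)} M × 𝔨`
is an isomorphism (`isInvertible_mfderiv_prod_form`), so the tangent space at `y` consists of the
values of the fields `Z̃ + a^#`, with `Z` a smooth vector field on `M`. Thus `L_W g_A = 0` can be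
tested on horizontal lifts and fundamental fields only (`isKilling_of_components`). The three
components of `L_W g_A` are the following.

* `(L_W g_A)(Z̃₁, Z̃₂) = (L_X g)(Z₁, Z₂) ∘ p`. Indeed `W` and `Z̃` are `p`-related to `X` and `Z`, hence
  `[W, Z̃]` is `p`-related to `[X, Z]` (`mfderiv_mlieBracket_of_related`), and `ω(Z̃) = 0`.
* `(L_W g_A)(Z̃, a^#) = ⟪F_A(X, Z) + ∇^A_Z ν, a⟫`. Indeed `W` is invariant under the right action, so
  that `[W, a^#] = 0` (`mlieBracket_fundamental_of_invariant`), and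
  `ω([W, Z̃]) = -F_A(X, Z) - ∇^A_Z ν` (`form_mlieBracket_liftAddVertical`): the bracket `[X̃, Z̃]`
  contributes the curvature, and `[ξ^ν, Z̃] = -(∇^A_Z ν)^#`, since `ξ^ν` is a combination of fundamental
  fields with the coordinates of `ν` as coefficients and fundamental fields commute with `Z̃`.
* `(L_W g_A)(a^#, b^#) = 0`, since `g_A(a^#, b^#) = ⟪a, b⟫` is constant and `[W, a^#] = [W, b^#] = 0`.

The first component vanishes for all `Z₁`, `Z₂` if and only if `X` is Killing, as `p` is surjective.
As `⟪·,·⟫` is definite, the second one vanishes for all `Z` and `a` if and only if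
`ι_X F_A = -∇^A ν`.

Two facts on vector fields are needed for this. The bracket is the commutator of derivations, also
for vector valued functions (`mvfderiv_mlieBracket`); applied to charts of the target this shows that
brackets of related fields are related, for arbitrary smooth maps. Horizontal lifts are smooth
(`isSmoothField_liftField`): in a local trivialization there is a smooth lift `S`, and
`Z̃ = S - ξ^{ω(S)}`.
-/

open Set
open scoped Topology

noncomputable section

namespace ConnectionMetric

/-! ### Vector fields as derivations, and related vector fields -/

section LieBracket

variable {E : Type*} [NormedAddCommGroup E] [NormedSpace ℝ E]
  {H : Type*} [TopologicalSpace H] {I : ModelWithCorners ℝ E H}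
  {M : Type*} [TopologicalSpace M] [ChartedSpace H M]
  {E' : Type*} [NormedAddCommGroup E'] [NormedSpace ℝ E']
  {H' : Type*} [TopologicalSpace H'] {J : ModelWithCorners ℝ E' H'}
  {N : Type*} [TopologicalSpace N] [ChartedSpace H' N] [IsManifold J ∞ N]
  {F : Type*} [NormedAddCommGroup F] [NormedSpace ℝ F]

/-- A map is `C^n` at `x` only if its expression in the preferred chart at `x` is. -/
theorem contDiffWithinAt_comp_extChartAt_symm {φ : M → F} {x : M} {n : WithTop ℕ∞}
    [IsManifold I n M]
    (hφ : ContMDiffAt I 𝓘(ℝ, F) n φ x) :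
    ContDiffWithinAt ℝ n (φ ∘ (extChartAt I x).symm) (range I) (extChartAt I x x) := by
  have h := (contMDiffAt_iff.1 hφ).2
  simpa only [preimage_univ, univ_inter, extChartAt_model_space_eq_id, PartialEquiv.refl_coe,
    Function.id_comp] using h

variable [IsManifold I ∞ M]

/-- The derivative of `φ` along `V`, computed in the preferred chart at `x`. -/
theorem fderivWithin_chart_apply {φ : M → F} {x : M} (V : ∀ z : M, TangentSpace I z)
    {e : E} (he : e ∈ (extChartAt I x).target)
    (hφ : MDifferentiableAt I 𝓘(ℝ, F) φ ((extChartAt I x).symm e)) :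
    fderivWithin ℝ (φ ∘ (extChartAt I x).symm) (range I) e
      (mpullbackWithin 𝓘(ℝ, E) I (extChartAt I x).symm V (range I) e) =
    mvfderiv I φ ((extChartAt I x).symm e) (V ((extChartAt I x).symm e)) := by
  rw [← mfderivWithin_eq_fderivWithin, mfderiv_comp_mfderivWithin (I' := I)]
  · have := isInvertible_mfderivWithin_extChartAt_symm (I := I) he
    simp only [mpullbackWithin_apply, mvfderiv]
    change mfderiv I 𝓘(ℝ, F) φ _
      ((mfderivWithin 𝓘(ℝ, E) I (extChartAt I x).symm (range I) e) _) = _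
    rw [this.self_apply_inverse]
    rfl
  · exact hφ
  · exact mdifferentiableWithinAt_extChartAt_symm he
  · exact I.uniqueMDiffOn _ (extChartAt_target_subset_range x he)

theorem eventuallyEq_mvfderiv_apply {φ : M → F} {x : M} (V : ∀ z : M, TangentSpace I z)
    (hφ : ContMDiffAt I 𝓘(ℝ, F) 2 φ x) :
    (fun z => mvfderiv I φ z (V z)) =ᶠ[𝓝 x]
      (fun e => fderivWithin ℝ (φ ∘ (extChartAt I x).symm) (range I) e
      (mpullbackWithin 𝓘(ℝ, E) I (extChartAt I x).symm V (range I) e)) ∘ extChartAt I x := by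
  filter_upwards [(contMDiffAt_iff_contMDiffAt_nhds (by simp)).1 hφ,
    extChartAt_source_mem_nhds (I := I) x] with z hz hzs
  have h := (extChartAt I x).left_inv hzs
  simp only [Function.comp]
  rw [fderivWithin_chart_apply V ((extChartAt I x).map_source hzs)
    (by rw [h]; exact hz.mdifferentiableAt (by simp)), h]

variable [CompleteSpace E]

theorem differentiableWithinAt_fderivWithin_chart {φ : M → F} {x : M}
    {V : ∀ z : M, TangentSpace I z}
    (hφ : ContMDiffAt I 𝓘(ℝ, F) 2 φ x)
    (hV : MDifferentiableAt I I.tangent (fun z => (⟨z, V z⟩ : TangentBundle I M)) x) :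
    DifferentiableWithinAt ℝ (fun e => fderivWithin ℝ (φ ∘ (extChartAt I x).symm) (range I) e
      (mpullbackWithin 𝓘(ℝ, E) I (extChartAt I x).symm V (range I) e)) (range I)
      (extChartAt I x x) := by
  have h1 := (contDiffWithinAt_comp_extChartAt_symm hφ).fderivWithin_right (m := 1) I.uniqueDiffOn
    (by norm_num) (mem_range_self _)
  have h2 := (mdifferentiableWithinAt_univ.2 hV).differentiableWithinAt_mpullbackWithin_vectorField
  simp only [preimage_univ, univ_inter] at h2
  exact (h1.differentiableWithinAt (by simp)).clm_apply h2

/-- The derivative of a `C^2` function along a differentiable vector field is differentiable. -/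
theorem mdifferentiableAt_mvfderiv_apply {φ : M → F} {x : M} {V : ∀ z : M, TangentSpace I z}
    (hφ : ContMDiffAt I 𝓘(ℝ, F) 2 φ x)
    (hV : MDifferentiableAt I I.tangent (fun z => (⟨z, V z⟩ : TangentBundle I M)) x) :
    MDifferentiableAt I 𝓘(ℝ, F) (fun z => mvfderiv I φ z (V z)) x := by
  refine MDifferentiableAt.congr_of_eventuallyEq ?_ (eventuallyEq_mvfderiv_apply V hφ)
  rw [← mdifferentiableWithinAt_univ]
  exact (differentiableWithinAt_fderivWithin_chart hφ hV).mdifferentiableWithinAt.comp x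
    (mdifferentiableAt_extChartAt (mem_chart_source H x)).mdifferentiableWithinAt
    (fun z _ => by simp [extChartAt])

/-- The iterated derivative of `φ` along `V` and then `W`, computed in the preferred chart. -/
theorem fderivWithin_fderivWithin_chart_apply {φ : M → F} {x : M} {V W : ∀ z : M, TangentSpace I z}
    (hφ : ContMDiffAt I 𝓘(ℝ, F) 2 φ x)
    (hV : MDifferentiableAt I I.tangent (fun z => (⟨z, V z⟩ : TangentBundle I M)) x) :
    fderivWithin ℝ (fun e => fderivWithin ℝ (φ ∘ (extChartAt I x).symm) (range I) e
      (mpullbackWithin 𝓘(ℝ, E) I (extChartAt I x).symm V (range I) e)) (range I)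
      (extChartAt I x x) (mpullbackWithin 𝓘(ℝ, E) I (extChartAt I x).symm W (range I)
      (extChartAt I x x)) = mvfderiv I (fun z => mvfderiv I φ z (V z)) x (W x) := by
  have h := fderivWithin_chart_apply (φ := fun z => mvfderiv I φ z (V z)) W
    (mem_extChartAt_target (I := I) x)
    (by rw [extChartAt_to_inv]; exact mdifferentiableAt_mvfderiv_apply hφ hV)
  rw [extChartAt_to_inv] at h
  rw [← h]
  congr 1
  refine Filter.EventuallyEq.fderivWithin_eq_of_mem ?_ (mem_range_self _)
  have h2 := (continuousAt_extChartAt_symm (I := I) x).eventually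
    (by rw [extChartAt_to_inv]; exact ((contMDiffAt_iff_contMDiffAt_nhds (by simp)).1 hφ))
  filter_upwards [extChartAt_target_mem_nhdsWithin (I := I) x, nhdsWithin_le_nhds h2] with e he h2e
  exact fderivWithin_chart_apply V he (h2e.mdifferentiableAt (by simp))

/-- The bracket of vector fields is the commutator of the associated derivations of (vector valued)
functions. -/
theorem mvfderiv_mlieBracket {φ : M → F} {x : M} {V W : ∀ z : M, TangentSpace I z}
    (hφ : ContMDiffAt I 𝓘(ℝ, F) 2 φ x)
    (hV : MDifferentiableAt I I.tangent (fun z => (⟨z, V z⟩ : TangentBundle I M)) x)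
    (hW : MDifferentiableAt I I.tangent (fun z => (⟨z, W z⟩ : TangentBundle I M)) x) :
    mvfderiv I φ x (mlieBracket I V W x) =
      mvfderiv I (fun z => mvfderiv I φ z (W z)) x (V x) -
        mvfderiv I (fun z => mvfderiv I φ z (V z)) x (W x) := by
  have hV' := (mdifferentiableWithinAt_univ.2 hV).differentiableWithinAt_mpullbackWithin_vectorField
  have hW' := (mdifferentiableWithinAt_univ.2 hW).differentiableWithinAt_mpullbackWithin_vectorField
  simp only [preimage_univ, univ_inter] at hV' hW'
  rw [← fderivWithin_fderivWithin_chart_apply hφ hV, ← fderivWithin_fderivWithin_chart_apply hφ hW,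
    ← fderivWithin_apply_lieBracket (contDiffWithinAt_comp_extChartAt_symm hφ) (by simp)
      I.uniqueDiffOn (I.range_subset_closure_interior (mem_range_self _)) (mem_range_self _) hW' hV',
    ← mlieBracketWithin_univ, mlieBracketWithin_apply,
    (hφ.mdifferentiableAt (by simp)).mvfderiv, mfderiv_extChartAt_self]
  simp only [preimage_univ, univ_inter]
  exact congrArg _ (congr($(ContinuousLinearMap.inverse_id) _))

/-- Brackets of `f`-related vector fields are `f`-related. -/
theorem mfderiv_mlieBracket_of_related [CompleteSpace E'] {f : M → N} {x : M}
    {V V' : ∀ z : M, TangentSpace I z} {W W' : ∀ z : N, TangentSpace J z}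
    (hf : ContMDiff I J ∞ f)
    (hV : MDifferentiableAt I I.tangent (fun z => (⟨z, V z⟩ : TangentBundle I M)) x)
    (hV' : MDifferentiableAt I I.tangent (fun z => (⟨z, V' z⟩ : TangentBundle I M)) x)
    (hW : MDifferentiableAt J J.tangent (fun z => (⟨z, W z⟩ : TangentBundle J N)) (f x))
    (hW' : MDifferentiableAt J J.tangent (fun z => (⟨z, W' z⟩ : TangentBundle J N)) (f x))
    (h : ∀ z, mfderiv I J f z (V z) = W (f z))
    (h' : ∀ z, mfderiv I J f z (V' z) = W' (f z)) :
    mfderiv I J f x (mlieBracket I V V' x) = mlieBracket J W W' (f x) := by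
  set φ := extChartAt J (f x) with hφ
  have hφs : ContMDiffAt J 𝓘(ℝ, E') 2 φ (f x) := contMDiffAt_extChartAt
  have hfx : ContMDiffAt I J 2 f x := (hf x).of_le ENat.LEInfty.out
  have hcomp := hφs.comp x hfx
  -- the derivation `V` of functions `φ ∘ f` is the pullback of the derivation `W` of `φ`
  have key (U : ∀ z : M, TangentSpace I z) (T : ∀ z : N, TangentSpace J z)
      (hU : ∀ z, mfderiv I J f z (U z) = T (f z)) :
      (fun z => mvfderiv I (φ ∘ f) z (U z)) =ᶠ[𝓝 x] (fun w => mvfderiv J φ w (T w)) ∘ f := by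
    have h1 := (contMDiffAt_iff_contMDiffAt_nhds (by simp)).1 hφs
    filter_upwards [hf.continuous.continuousAt.eventually h1] with z hz
    have := mfderiv_comp_apply (I := I) (I' := J) z (hz.mdifferentiableAt (by simp))
      (hf.mdifferentiableAt (by simp)) (U z)
    simp only [Function.comp_apply, ← hU z]
    exact this
  have key2 (u : N → E') (hu : MDifferentiableAt J 𝓘(ℝ, E') u (f x)) (v : TangentSpace I x) :
      mvfderiv I (u ∘ f) x v = mvfderiv J u (f x) (mfderiv I J f x v) :=
    mfderiv_comp_apply (I := I) (I' := J) x hu (hf.mdifferentiableAt (by simp)) v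
  have e1 : mvfderiv I (φ ∘ f) x (mlieBracket I V V' x) =
      mvfderiv J φ (f x) (mlieBracket J W W' (f x)) := by
    rw [mvfderiv_mlieBracket hcomp hV hV', mvfderiv_mlieBracket hφs hW hW', ← h x, ← h' x,
      ← key2 _ (mdifferentiableAt_mvfderiv_apply hφs hW'),
      ← key2 _ (mdifferentiableAt_mvfderiv_apply hφs hW)]
    have a1 := (key V W h).mfderiv_eq (I := I) (I' := 𝓘(ℝ, E'))
    have a2 := (key V' W' h').mfderiv_eq (I := I) (I' := 𝓘(ℝ, E'))
    unfold mvfderiv at a1 a2 ⊢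
    rw [a1, a2]
    rfl
  rw [key2 φ (hφs.mdifferentiableAt (by simp))] at e1
  -- the chart at `f x` has the identity as its derivative at `f x`
  unfold mvfderiv at e1
  rw [hφ, mfderiv_extChartAt_self] at e1
  exact e1

end LieBracket

/-! ### The Lie derivative of a metric is tensorial -/

section Tensoriality

variable {E : Type*} [NormedAddCommGroup E] [NormedSpace ℝ E]
  {H : Type*} [TopologicalSpace H] {I : ModelWithCorners ℝ E H}
  {M : Type*} [TopologicalSpace M] [ChartedSpace H M]

theorem lieDerivBilin_comm {h : ∀ x : M, TangentSpace I x →L[ℝ] TangentSpace I x →L[ℝ] ℝ}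
    (hsymm : ∀ x v w, h x v w = h x w v) (X U V : ∀ x : M, TangentSpace I x) (x : M) :
    lieDerivBilin I X h U V x = lieDerivBilin I X h V U x := by
  unfold lieDerivBilin
  simp only [fun z => hsymm z (U z) (V z)]
  rw [hsymm x (mlieBracket I X U x), hsymm x (U x)]
  ring

variable [CompleteSpace E] [IsManifold I ∞ M]

/-- The Lie derivative `(L_X h)(U, V)` is tensorial in `U`: the terms with a derivative of the
coefficient of `U` in `X (h(U, V))` and in `h([X, U], V)` cancel. -/
theorem tensorialAt_lieDerivBilin_left
    {h : ∀ x : M, TangentSpace I x →L[ℝ] TangentSpace I x →L[ℝ] ℝ} {x : M}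
    (hdiff : ∀ U V : ∀ x : M, TangentSpace I x,
      MDifferentiableAt I I.tangent (fun z => (⟨z, U z⟩ : TangentBundle I M)) x →
      MDifferentiableAt I I.tangent (fun z => (⟨z, V z⟩ : TangentBundle I M)) x →
      MDifferentiableAt I 𝓘(ℝ, ℝ) (fun z => h z (U z) (V z)) x)
    (X V : ∀ x : M, TangentSpace I x)
    (hV : MDifferentiableAt I I.tangent (fun z => (⟨z, V z⟩ : TangentBundle I M)) x) :
    TensorialAt I E (fun U => lieDerivBilin I X h U V x) x where
  smul {f σ} hf hσ := by
    simp only [lieDerivBilin]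
    rw [mlieBracket_smul_right hf hσ]
    simp only [Pi.smul_apply', map_smul, smul_apply, smul_eq_mul, map_add, add_apply]
    rw [mvfderiv_fun_mul hf (hdiff _ _ hσ hV)]
    simp only [add_apply, smul_apply, smul_eq_mul]
    ring
  add {σ σ'} hσ hσ' := by
    simp only [lieDerivBilin]
    rw [mlieBracket_add_right hσ hσ']
    simp only [Pi.add_apply, map_add, add_apply]
    rw [mvfderiv_fun_add (hdiff _ _ hσ hV) (hdiff _ _ hσ' hV)]
    simp only [add_apply]
    ring

end Tensoriality

/-! ### Fundamental fields and invariant vector fields -/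

section Action

variable
  {EK : Type*} [NormedAddCommGroup EK] [NormedSpace ℝ EK]
  {HK : Type*} [TopologicalSpace HK] {IK : ModelWithCorners ℝ EK HK}
  {K : Type*} [TopologicalSpace K] [ChartedSpace HK K]
  {EP : Type*} [NormedAddCommGroup EP] [NormedSpace ℝ EP]
  {HP : Type*} [TopologicalSpace HP] {IP : ModelWithCorners ℝ EP HP}
  {P : Type*} [TopologicalSpace P] [ChartedSpace HP P]

/-- A smooth map to a vector space is smooth as a map to a fixed tangent space, viewed as a subset of
the tangent bundle. -/
theorem contMDiffAt_mk_const_tangentBundle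
    {E : Type*} [NormedAddCommGroup E] [NormedSpace ℝ E]
    {H : Type*} [TopologicalSpace H] {I : ModelWithCorners ℝ E H}
    {M : Type*} [TopologicalSpace M] [ChartedSpace H M] [IsManifold I ∞ M]
    {f : P → E} {y : P} (x : M) (hf : ContMDiffAt IP 𝓘(ℝ, E) ∞ f y) :
    ContMDiffAt IP I.tangent ∞ (fun z => (⟨x, f z⟩ : TangentBundle I M)) y := by
  rw [contMDiffAt_totalSpace]
  refine ⟨contMDiffAt_const, ?_⟩
  -- the trivialization of the tangent bundle at `x` is the identity on the fibre at `x`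
  have h (v : E) : ((trivializationAt E (TangentSpace I) x) (⟨x, v⟩ : TangentBundle I M)).2 = v := by
    have h1 := TangentBundle.continuousLinearMapAt_trivializationAt (I := I) (mem_chart_source H x)
    rw [mfderiv_extChartAt_self] at h1
    have h2 := congr($h1 v)
    rw [Trivialization.continuousLinearMapAt_apply, Trivialization.coe_linearMapAt_of_mem _
      (FiberBundle.mem_baseSet_trivializationAt' x)] at h2
    exact h2
  simpa only [h] using hf

theorem contMDiffAt_tangentBundle_prodMk
    {E : Type*} [NormedAddCommGroup E] [NormedSpace ℝ E]
    {H : Type*} [TopologicalSpace H] {I : ModelWithCorners ℝ E H}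
    {M : Type*} [TopologicalSpace M] [ChartedSpace H M] [IsManifold I ∞ M]
    {E' : Type*} [NormedAddCommGroup E'] [NormedSpace ℝ E']
    {H' : Type*} [TopologicalSpace H'] {J : ModelWithCorners ℝ E' H'}
    {N : Type*} [TopologicalSpace N] [ChartedSpace H' N] [IsManifold J ∞ N]
    {n : WithTop ℕ∞} (hn : n + 1 ≤ ∞) {f : P → TangentBundle I M} {g : P → TangentBundle J N}
    {y : P}
    (hf : ContMDiffAt IP I.tangent n f y) (hg : ContMDiffAt IP J.tangent n g y) :
    ContMDiffAt IP (I.prod J).tangent n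
      (fun z => (⟨((f z).1, (g z).1), ((f z).2, (g z).2)⟩ : TangentBundle (I.prod J) (M × N))) y :=
  haveI : IsManifold I (n + 1) M := .of_le hn
  haveI : IsManifold J (n + 1) N := .of_le hn
  (contMDiff_equivTangentBundleProd_symm (n := n)).contMDiffAt.comp y (hf.prodMk hg)

variable [Group K] [MulAction Kᵐᵒᵖ P]
  (hact : ContMDiff (IP.prod IK) IP ∞ (fun q : P × K => op q.2 • q.1))
include hact

theorem contMDiff_orbit (y : P) : ContMDiff IK IP ∞ (fun k : K => op k • y) :=
  hact.comp (contMDiff_const.prodMk contMDiff_id)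

theorem contMDiff_rightMul (k : K) : ContMDiff IP IP ∞ (fun y : P => op k • y) :=
  hact.comp (contMDiff_id.prodMk contMDiff_const)

theorem mfderiv_action (y : P) (k : K) (v : TangentSpace IP y) (w : TangentSpace IK k) :
    mfderiv (IP.prod IK) IP (fun q : P × K => op q.2 • q.1) (y, k) (v, w) =
      (mfderiv IP IP (fun z : P => op k • z) y v : EP) +
        mfderiv IK IP (fun h : K => op h • y) k w :=
  mfderiv_prod_eq_add_apply (I := IP) (I' := IK) (I'' := IP)
    (v := (show TangentSpace (IP.prod IK) (y, k) from (v, w))) (hact.mdifferentiableAt (by simp))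

variable [LieGroup IK ∞ K]

/-- The orbit map of `y` sends the left invariant field of `a` to the fundamental field of `a`,
because `y (k h) = (y k) h`. -/
theorem mfderiv_orbit_mulInvariantVectorField (y : P) (k : K) (a : GroupLieAlgebra IK K) :
    mfderiv IK IP (fun h : K => op h • y) k (mulInvariantVectorField a k) =
      fundamental IK IP (op k • y) a := by
  have h1 : (fun h : K => op h • op k • y) = (fun h : K => op h • y) ∘ (fun h => k * h) := by
    ext h; simp [mul_smul]
  have h2 := mfderiv_comp_apply_of_eq (I := IK) (I' := IK) (I'' := IP) (x := (1 : K)) (y := k)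
    (g := fun h : K => op h • y) (f := fun h => k * h)
    ((contMDiff_orbit hact y).mdifferentiableAt (by simp))
    ((contMDiff_mul_left (I := IK) (n := ∞)).mdifferentiableAt (by simp)) (mul_one k) a
  rw [← h1] at h2
  exact h2.symm

/-- `R_k` sends `a^#` to `(Ad(k⁻¹) a)^#`, because `(y h) k = (y k) (k⁻¹ h k)`. -/
theorem mfderiv_rightMul_fundamental (y : P) (k : K) (a : GroupLieAlgebra IK K) :
    mfderiv IP IP (fun z : P => op k • z) y (fundamental IK IP y a) =
      fundamental IK IP (op k • y) (Ad IK k⁻¹ a) := by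
  have h1 : (fun z : P => op k • z) ∘ (fun h : K => op h • y) =
      (fun h : K => op h • op k • y) ∘ (fun h => k⁻¹ * h * k⁻¹⁻¹) := by
    ext h; simp [← mul_smul, ← op_mul, mul_assoc]
  have hc : ContMDiff IK IK ∞ (fun h : K => k⁻¹ * h * k⁻¹⁻¹) :=
    (contMDiff_mul_right (I := IK) (n := ∞)).comp contMDiff_mul_left
  have h2 := mfderiv_comp_apply_of_eq (I := IK) (I' := IP) (I'' := IP) (x := (1 : K)) (y := y)
    (g := fun z : P => op k • z) (f := fun h : K => op h • y)
    ((contMDiff_rightMul hact k).mdifferentiableAt (by simp))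
    ((contMDiff_orbit hact y).mdifferentiableAt (by simp)) (by simp) a
  have h3 := mfderiv_comp_apply_of_eq (I := IK) (I' := IK) (I'' := IP) (x := (1 : K)) (y := 1)
    (g := fun h : K => op h • op k • y) (f := fun h => k⁻¹ * h * k⁻¹⁻¹)
    ((contMDiff_orbit hact _).mdifferentiableAt (by simp))
    (hc.mdifferentiableAt (by simp)) (by simp) a
  rw [← h1, h2] at h3
  exact h3

variable [IsManifold IP ∞ P]

/-- The field `ξ^f` is smooth where `f` is: it is the image of `(0_y, f(y)) ∈ T_y P × T_1 K` under the
derivative of the action map. -/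
theorem contMDiffAt_verticalField {f : P → GroupLieAlgebra IK K} {y : P}
    (hf : ContMDiffAt IP 𝓘(ℝ, EK) (M' := EK) ∞ f y) :
    ContMDiffAt IP IP.tangent ∞
      (fun z => (⟨z, verticalField IK IP f z⟩ : TangentBundle IP P)) y := by
  have h0 : ContMDiffAt IP IP.tangent ∞ (fun z : P => (⟨z, 0⟩ : TangentBundle IP P)) y :=
    (contMDiff_zeroSection ℝ (TangentSpace IP : P → Type _)).contMDiffAt
  have h1 := contMDiffAt_mk_const_tangentBundle (I := IK) (1 : K) hf
  have h2 := contMDiffAt_tangentBundle_prodMk le_rfl h0 h1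
  have h3 := (hact.contMDiff_tangentMap (m := ∞) le_rfl).contMDiffAt.comp y h2
  refine h3.congr_of_eventuallyEq (Filter.Eventually.of_forall fun z => ?_)
  simp only [Function.comp, tangentMap]
  refine TotalSpace.ext (by simp) ?_
  simp only [op_one]
  refine heq_of_eq ?_
  refine Eq.trans ?_ (mfderiv_action hact z 1 0 (f z)).symm
  rw [map_zero, zero_add]
  rfl

theorem isSmoothField_verticalField {f : P → GroupLieAlgebra IK K}
    (hf : ContMDiff IP 𝓘(ℝ, EK) (M' := EK) ∞ f) :
    IsSmoothField IP (verticalField IK IP f) :=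
  fun _ => contMDiffAt_verticalField hact hf.contMDiffAt

/-- Vector fields invariant under the right action commute with the fundamental fields: on `P × K`
the fields `(W, 0)` and `(0, a^L)`, with `a^L` left invariant, commute, and they are related by
the action map to `W` and to `a^#`. -/
theorem mlieBracket_fundamental_of_invariant [CompleteSpace EP] [CompleteSpace EK]
    {W : ∀ z : P, TangentSpace IP z} (hW : IsSmoothField IP W)
    (hinv : ∀ (k : K) (z : P), mfderiv IP IP (fun z : P => op k • z) z (W z) = W (op k • z))
    (a : GroupLieAlgebra IK K) (y : P) :
    mlieBracket IP W (verticalField IK IP fun _ => a) y = 0 := by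
  have h2 : (1 : WithTop ℕ∞) + 1 ≤ ∞ := by rw [one_add_one_eq_two]; exact ENat.LEInfty.out
  let W' : ∀ q : P × K, TangentSpace (IP.prod IK) q := fun q => (W q.1, (0 : EK))
  let L : ∀ q : P × K, TangentSpace (IP.prod IK) q :=
    fun q => ((0 : EP), mulInvariantVectorField (I := IK) a q.2)
  have : LieGroup IK (minSmoothness ℝ 3) K := by
    simp only [minSmoothness_of_isRCLikeNormedField]; infer_instance
  have ha : ContMDiff IK IK.tangent 1
      (fun k : K => (⟨k, mulInvariantVectorField a k⟩ : TangentBundle IK K)) :=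
    (contMDiff_mulInvariantVectorField (I := IK) a).of_le (by simp)
  have hW1 : ContMDiff IP IP.tangent 1 (fun z => (⟨z, W z⟩ : TangentBundle IP P)) :=
    hW.of_le (by simp)
  have h0P : ContMDiff IP IP.tangent 1 (fun z : P => (⟨z, 0⟩ : TangentBundle IP P)) :=
    contMDiff_zeroSection ℝ (TangentSpace IP : P → Type _)
  have h0K : ContMDiff IK IK.tangent 1 (fun z : K => (⟨z, 0⟩ : TangentBundle IK K)) :=
    contMDiff_zeroSection ℝ (TangentSpace IK : K → Type _)
  have hW' : MDifferentiableAt (IP.prod IK) (IP.prod IK).tangent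
      (fun q => (⟨q, W' q⟩ : TangentBundle (IP.prod IK) (P × K))) (y, 1) :=
    (contMDiffAt_tangentBundle_prodMk (n := 1) h2 (hW1.comp contMDiff_fst).contMDiffAt
      (h0K.comp contMDiff_snd).contMDiffAt).mdifferentiableAt (by simp)
  have hL : MDifferentiableAt (IP.prod IK) (IP.prod IK).tangent
      (fun q => (⟨q, L q⟩ : TangentBundle (IP.prod IK) (P × K))) (y, 1) :=
    (contMDiffAt_tangentBundle_prodMk (n := 1) h2 (h0P.comp contMDiff_fst).contMDiffAt
      (ha.comp contMDiff_snd).contMDiffAt).mdifferentiableAt (by simp)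
  have hWy : ∀ y, MDifferentiableAt IP IP.tangent (fun z => (⟨z, W z⟩ : TangentBundle IP P)) y :=
    fun y => hW1.mdifferentiableAt (by simp)
  have hAy : ∀ y, MDifferentiableAt IP IP.tangent
      (fun z => (⟨z, verticalField IK IP (fun _ => a) z⟩ : TangentBundle IP P)) y :=
    fun y => (isSmoothField_verticalField hact contMDiff_const).mdifferentiableAt (by simp)
  -- the components of `[W', L]` are `[W, 0]` and `[0, a^L]`
  have b1 := mfderiv_mlieBracket_of_related (V := W') (V' := L) (W := W)
    (W' := fun _ => 0) contMDiff_fst hW' hL (hWy _) (h0P.mdifferentiableAt (by simp))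
    (fun z => by rw [mfderiv_fst]; rfl) (fun z => by rw [mfderiv_fst]; rfl)
  have b2 := mfderiv_mlieBracket_of_related (V := W') (V' := L) (W := fun _ => 0)
    (W' := mulInvariantVectorField (I := IK) a) contMDiff_snd hW' hL
    (h0K.mdifferentiableAt (by simp))
    (ha.mdifferentiableAt (by simp))
    (fun z => by rw [mfderiv_snd]; rfl) (fun z => by rw [mfderiv_snd]; rfl)
  have b0 : mlieBracket (IP.prod IK) W' L (y, 1) = 0 := by
    rw [mfderiv_fst] at b1
    rw [mfderiv_snd] at b2
    refine Prod.ext (b1.trans ?_) (b2.trans ?_)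
    · exact congr($(mlieBracket_zero_right) _)
    · exact congr($(mlieBracket_zero_left) _)
  have b3 := mfderiv_mlieBracket_of_related (V := W') (V' := L) (W := W)
    (W' := verticalField IK IP fun _ => a) hact hW' hL (hWy _) (hAy _)
    (fun z => by
      refine (mfderiv_action hact z.1 z.2 (W z.1) 0).trans ?_
      rw [map_zero, add_zero]; exact hinv _ _)
    (fun z => by
      refine (mfderiv_action hact z.1 z.2 0 (mulInvariantVectorField a z.2)).trans ?_
      rw [map_zero, zero_add]; exact mfderiv_orbit_mulInvariantVectorField hact _ _ _)
  rw [b0, map_zero] at b3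
  -- `b3` is an equality at the point `y 1`, which is propositionally equal to `y`
  have h3 : ∀ z, z = y → 0 = mlieBracket IP W (verticalField IK IP fun _ => a) z →
      mlieBracket IP W (verticalField IK IP fun _ => a) y = 0 := by
    rintro _ rfl h
    exact h.symm
  exact h3 _ (by simp) b3

end Action

/-! ### Vertical vectors and horizontal lifts on a principal bundle -/

section PrincipalBundle

variable {EM : Type*} [NormedAddCommGroup EM] [NormedSpace ℝ EM]
  {HM : Type*} [TopologicalSpace HM] {IM : ModelWithCorners ℝ EM HM}
  {M : Type*} [TopologicalSpace M] [ChartedSpace HM M]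
  {EK : Type*} [NormedAddCommGroup EK] [NormedSpace ℝ EK]
  {HK : Type*} [TopologicalSpace HK] {IK : ModelWithCorners ℝ EK HK}
  {K : Type*} [TopologicalSpace K] [ChartedSpace HK K] [Group K]
  {EP : Type*} [NormedAddCommGroup EP] [NormedSpace ℝ EP]
  {HP : Type*} [TopologicalSpace HP] {IP : ModelWithCorners ℝ EP HP}
  {P : Type*} [TopologicalSpace P] [ChartedSpace HP P]
  [MulAction Kᵐᵒᵖ P] {p : P → M}

theorem IsPrincipalBundle.surjective (hp : IsPrincipalBundle IM IK K IP p) :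
    Function.Surjective p := by
  intro x
  obtain ⟨e, hx, -⟩ := hp.exists_trivialization x
  exact ⟨e.toOpenPartialHomeomorph.symm (x, 1), e.proj_symm_apply' hx⟩

theorem IsPrincipalBundle.mfderiv_fundamental (hp : IsPrincipalBundle IM IK K IP p) (y : P)
    (a : GroupLieAlgebra IK K) : mfderiv IP IM p y (fundamental IK IP y a) = 0 := by
  have h := mfderiv_comp_apply_of_eq (I := IK) (I' := IP) (I'' := IM) (x := (1 : K)) (y := y)
    (g := p) (f := fun k : K => op k • y) (hp.contMDiff_proj.mdifferentiableAt (by simp))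
    ((contMDiff_orbit hp.contMDiff_action y).mdifferentiableAt (by simp)) (by simp) a
  have hc : p ∘ (fun k : K => op k • y) = fun _ => p y := by
    ext k; exact hp.proj_action y k
  rw [hc, mfderiv_const] at h
  exact h.symm

/-- The derivative of a smooth principal bundle projection is surjective. -/
theorem IsPrincipalBundle.mfderiv_surjective (hp : IsPrincipalBundle IM IK K IP p) (y : P) :
    Function.Surjective (mfderiv IP IM p y) := by
  obtain ⟨e, hx, he, hes, -⟩ := hp.exists_trivialization (p y)
  have hy : y ∈ e.source := e.mem_source.2 hx
  set Ψ := e.toOpenPartialHomeomorph.symm with hΨ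
  intro u
  have hΨz : MDifferentiableAt (IM.prod IK) IP Ψ (e y) :=
    (hes.contMDiffAt (e.open_target.mem_nhds (e.map_source hy))).mdifferentiableAt (by simp)
  have h1 := mfderiv_comp_apply_of_eq (I := IM.prod IK) (I' := IP) (I'' := IM) (x := e y) (y := y)
    (g := p) (f := Ψ) (hp.contMDiff_proj.mdifferentiableAt (by simp)) hΨz (e.left_inv hy)
    (u, (0 : EK))
  have h1' : (p ∘ Ψ) =ᶠ[𝓝 (e y)] Prod.fst := by
    filter_upwards [e.open_target.mem_nhds (e.map_source hy)] with q hq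
      using e.proj_symm_apply hq
  rw [h1'.mfderiv_eq, mfderiv_fst] at h1
  exact ⟨_, h1.symm⟩

theorem PrincipalConnection.contMDiffAt_form_apply [IsManifold IP ∞ P]
    (A : PrincipalConnection IK K IP P)
    {U : ∀ y : P, TangentSpace IP y} {y : P}
    (hU : ContMDiffAt IP IP.tangent ∞ (fun z => (⟨z, U z⟩ : TangentBundle IP P)) y) :
    ContMDiffAt IP 𝓘(ℝ, EK) (M' := EK) ∞ (fun z => A.form z (U z)) y :=
  A.contMDiff_form.contMDiffAt.comp y hU

variable [LieGroup IK ∞ K]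

/-- The vertical tangent vectors are the values of the fundamental fields. -/
theorem IsPrincipalBundle.exists_fundamental_eq (hp : IsPrincipalBundle IM IK K IP p) (y : P)
    (v : TangentSpace IP y) (hv : mfderiv IP IM p y v = 0) :
    ∃ a : GroupLieAlgebra IK K, fundamental IK IP y a = v := by
  obtain ⟨e, hx, he, hes, heq⟩ := hp.exists_trivialization (p y)
  have hy : y ∈ e.source := e.mem_source.2 hx
  set Ψ := e.toOpenPartialHomeomorph.symm with hΨ
  have hey : MDifferentiableAt IP (IM.prod IK) e y :=
    (he.contMDiffAt (e.open_source.mem_nhds hy)).mdifferentiableAt (by simp)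
  have hΨy : MDifferentiableAt (IM.prod IK) IP Ψ (e y) :=
    (hes.contMDiffAt (e.open_target.mem_nhds (e.map_source hy))).mdifferentiableAt (by simp)
  -- the derivative of `e` maps `v` to a vector `(0, w)`
  have h1 := mfderiv_comp_apply (I := IP) (I' := IM.prod IK) (I'' := IM) (g := Prod.fst) y
    mdifferentiableAt_fst hey v
  have h1' : (Prod.fst ∘ e) =ᶠ[𝓝 y] p := by
    filter_upwards [e.open_source.mem_nhds hy] with z hz using e.coe_fst hz
  replace h1 := h1.symm.trans (congr($(h1'.mfderiv_eq) v).trans hv)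
  rw [mfderiv_fst] at h1
  -- `v` is the derivative of `Ψ` applied to `(0, w)`
  have h2 := mfderiv_comp_apply (I := IP) (I' := IM.prod IK) (I'' := IP) (g := Ψ) y hΨy hey v
  have h2' : (Ψ ∘ e) =ᶠ[𝓝 y] id := by
    filter_upwards [e.open_source.mem_nhds hy] with z hz using e.left_inv hz
  replace h2 := h2.symm.trans congr($(h2'.mfderiv_eq.trans mfderiv_id) v)
  set w : EK := (mfderiv IP (IM.prod IK) e y v : EM × EK).2 with hw
  have h3 : (mfderiv IP (IM.prod IK) e y v : EM × EK) = (0, w) := Prod.ext h1 rfl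
  -- the curve `k ↦ Ψ (p y, k)` is an orbit
  set k₀ := (e y).2 with hk₀
  have hek : e y = (p y, k₀) := Prod.ext (e.coe_fst hy) rfl
  have h4 : (fun k : K => Ψ (p y, k)) = (fun k : K => op k • y) ∘ (fun k => k₀⁻¹ * k) := by
    ext k
    have hs : op (k₀⁻¹ * k) • y ∈ e.source := by
      rw [e.mem_source, hp.proj_action]; exact hx
    have : e (op (k₀⁻¹ * k) • y) = (p y, k) := by
      refine Prod.ext ((e.coe_fst hs).trans (hp.proj_action _ _)) ?_
      rw [heq y hy]; simp [hk₀]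
    simp only [Function.comp, ← this]
    exact e.left_inv hs
  have h5 := mfderiv_comp_apply_of_eq (I := IK) (I' := IM.prod IK) (I'' := IP) (x := k₀)
    (g := Ψ) (f := fun k => (p y, k)) hΨy
    (mdifferentiableAt_const.prodMk mdifferentiableAt_id) hek.symm w
  rw [mfderiv_prod_right] at h5
  have h6 := mfderiv_comp_apply_of_eq (I := IK) (I' := IK) (I'' := IP) (x := k₀) (y := 1)
    (g := fun k : K => op k • y) (f := fun k => k₀⁻¹ * k)
    ((contMDiff_orbit hp.contMDiff_action y).mdifferentiableAt (by simp))
    ((contMDiff_mul_left (I := IK) (n := ∞)).mdifferentiableAt (by simp)) (by simp) w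
  rw [← h4] at h6
  refine ⟨mfderiv IK IK (fun k => k₀⁻¹ * k) k₀ w, ?_⟩
  refine h6.symm.trans (h5.trans ?_)
  refine Eq.trans ?_ h2
  exact congrArg (mfderiv (IM.prod IK) IP Ψ (e y)) h3.symm

variable [IsManifold IP ∞ P]

/-- The map `(dp, ω) : T_y P → T_{p(y)} M × 𝔨` is injective. -/
theorem eq_of_mfderiv_eq_of_form_eq (hp : IsPrincipalBundle IM IK K IP p)
    (A : PrincipalConnection IK K IP P) {y : P} {v w : TangentSpace IP y}
    (h : mfderiv IP IM p y v = mfderiv IP IM p y w) (h' : A.form y v = A.form y w) : v = w := by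
  obtain ⟨a, ha⟩ := hp.exists_fundamental_eq y (v - w) (by rw [map_sub, h, sub_self])
  have h0 : A.form y (v - w) = 0 := by rw [map_sub, h', sub_self]
  rw [← ha, A.form_fundamental] at h0
  rw [h0, map_zero] at ha
  exact (sub_eq_zero.1 ha.symm)

/-- Near each point, a smooth vector field on the base has a smooth lift. -/
theorem IsPrincipalBundle.exists_local_lift [IsManifold IM ∞ M]
    (hp : IsPrincipalBundle IM IK K IP p)
    {Z : ∀ x : M, TangentSpace IM x} (hZ : IsSmoothField IM Z) (y : P) :
    ∃ S : ∀ z : P, TangentSpace IP z,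
      ContMDiffAt IP IP.tangent ∞ (fun z => (⟨z, S z⟩ : TangentBundle IP P)) y ∧
      ∀ᶠ z in 𝓝 y, mfderiv IP IM p z (S z) = Z (p z) := by
  obtain ⟨e, hx, he, hes, -⟩ := hp.exists_trivialization (p y)
  have hy : y ∈ e.source := e.mem_source.2 hx
  set Ψ := e.toOpenPartialHomeomorph.symm with hΨ
  -- in the trivialization, take the lift `(Z, 0)`
  refine ⟨fun z => mfderiv (IM.prod IK) IP Ψ (e z) (Z (p z), (0 : EK)), ?_, ?_⟩
  · have h1 : ContMDiffAt IP IM.tangent ∞ (fun z => (⟨p z, Z (p z)⟩ : TangentBundle IM M)) y :=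
      (hZ.comp hp.contMDiff_proj).contMDiffAt
    have h2 : ContMDiffAt IP IK.tangent ∞ (fun z => (⟨(e z).2, 0⟩ : TangentBundle IK K)) y :=
      (contMDiff_zeroSection ℝ (TangentSpace IK : K → Type _)).contMDiffAt.comp y
        (contMDiffAt_snd.comp y (he.contMDiffAt (e.open_source.mem_nhds hy)))
    have h3 := contMDiffAt_tangentBundle_prodMk le_rfl h1 h2
    have h4 := hes.contMDiffOn_tangentMapWithin (m := ∞) le_rfl e.open_target.uniqueMDiffOn
    have h5 : (π (EM × EK) (TangentSpace (IM.prod IK) : M × K → Type _)) ⁻¹' e.target ∈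
        𝓝 ((⟨(p y, (e y).2), (Z (p y), (0 : EK))⟩ : TangentBundle (IM.prod IK) (M × K))) := by
      refine (e.open_target.preimage (FiberBundle.continuous_proj _ _)).mem_nhds ?_
      simpa [e.mem_target] using hx
    refine ((h4.contMDiffAt h5).comp y h3).congr_of_eventuallyEq ?_
    filter_upwards [e.open_source.mem_nhds hy] with z hz
    have hez : ((p z, (e z).2) : M × K) = e z := Prod.ext (e.coe_fst hz).symm rfl
    simp only [Function.comp, tangentMapWithin]
    refine TotalSpace.ext ?_ ?_
    · rw [hez]; exact (e.left_inv hz).symm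
    · refine heq_of_eq ?_
      rw [mfderivWithin_of_mem_nhds (e.open_target.mem_nhds (by rw [hez]; exact e.map_source hz))]
      rw [hez]
      rfl
  · filter_upwards [e.open_source.mem_nhds hy] with z hz
    have hΨz : MDifferentiableAt (IM.prod IK) IP Ψ (e z) :=
      (hes.contMDiffAt (e.open_target.mem_nhds (e.map_source hz))).mdifferentiableAt (by simp)
    have h1 := mfderiv_comp_apply_of_eq (I := IM.prod IK) (I' := IP) (I'' := IM) (x := e z) (y := z)
      (g := p) (f := Ψ) (hp.contMDiff_proj.mdifferentiableAt (by simp)) hΨz (e.left_inv hz)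
      (Z (p z), (0 : EK))
    have h1' : (p ∘ Ψ) =ᶠ[𝓝 (e z)] Prod.fst := by
      filter_upwards [e.open_target.mem_nhds (e.map_source hz)] with q hq
        using e.proj_symm_apply hq
    rw [h1'.mfderiv_eq, mfderiv_fst] at h1
    exact h1.symm

variable [FiniteDimensional ℝ EP]

theorem isInvertible_mfderiv_prod_form (hp : IsPrincipalBundle IM IK K IP p)
    (A : PrincipalConnection IK K IP P) (y : P) :
    ((mfderiv IP IM p y).prod (A.form y)).IsInvertible := by
  let f : EP →L[ℝ] EM × EK := (mfderiv IP IM p y).prod (A.form y)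
  have hinj : Function.Injective f := fun v w h =>
    eq_of_mfderiv_eq_of_form_eq hp A congr(($h).1) congr(($h).2)
  have hsurj : Function.Surjective f := by
    rintro ⟨u, a⟩
    obtain ⟨v, hv⟩ := hp.mfderiv_surjective y u
    let a : GroupLieAlgebra IK K := a
    refine ⟨v + fundamental IK IP y (a - A.form y v), Prod.ext ?_ ?_⟩
    · have h1 := map_add (mfderiv IP IM p y) v (fundamental IK IP y (a - A.form y v))
      rw [hp.mfderiv_fundamental, add_zero, hv] at h1
      exact h1
    · have h1 := map_add (A.form y) v (fundamental IK IP y (a - A.form y v))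
      rw [A.form_fundamental, add_sub_cancel] at h1
      exact h1
  exact ⟨(LinearEquiv.ofBijective f.toLinearMap ⟨hinj, hsurj⟩).toContinuousLinearEquiv, by
    ext v <;> rfl⟩

theorem mfderiv_horizontalLift (hp : IsPrincipalBundle IM IK K IP p)
    (A : PrincipalConnection IK K IP P) (y : P) (u : TangentSpace IM (p y)) :
    mfderiv IP IM p y (horizontalLift IM A p y u) = u :=
  congr(($((isInvertible_mfderiv_prod_form hp A y).self_apply_inverse (u, 0))).1)

theorem form_horizontalLift (hp : IsPrincipalBundle IM IK K IP p)
    (A : PrincipalConnection IK K IP P) (y : P) (u : TangentSpace IM (p y)) :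
    A.form y (horizontalLift IM A p y u) = 0 :=
  congr(($((isInvertible_mfderiv_prod_form hp A y).self_apply_inverse (u, 0))).2)

/-- Horizontal lifts are invariant under the right action. -/
theorem mfderiv_rightMul_liftField (hp : IsPrincipalBundle IM IK K IP p)
    (A : PrincipalConnection IK K IP P) (Z : ∀ x : M, TangentSpace IM x) (k : K) (y : P) :
    mfderiv IP IP (fun z : P => op k • z) y (liftField IM A p Z y) =
      liftField IM A p Z (op k • y) := by
  refine eq_of_mfderiv_eq_of_form_eq hp A ?_ ?_
  · have h := mfderiv_comp_apply (I := IP) (I' := IP) (I'' := IM) (g := p)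
      (f := fun z : P => op k • z) y (hp.contMDiff_proj.mdifferentiableAt (by simp))
      ((contMDiff_rightMul hp.contMDiff_action k).mdifferentiableAt (by simp))
      (liftField IM A p Z y)
    have hc : p ∘ (fun z : P => op k • z) = p := funext fun z => hp.proj_action z k
    refine h.symm.trans ?_
    change _ = mfderiv IP IM p (op k • y)
      (horizontalLift IM A p (op k • y) (Z (p (op k • y))))
    rw [mfderiv_horizontalLift hp]
    -- the next two statements compare vectors in tangent spaces at `p (y k)` and at `p y`
    have h2 : ∀ q : P → M, q = p → ∀ v : TangentSpace IP y,
        (mfderiv IP IM q y v : EM) = mfderiv IP IM p y v := by rintro _ rfl v; rfl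
    refine Eq.trans (h2 _ hc _) ?_
    rw [liftField, mfderiv_horizontalLift hp]
    have h3 : ∀ x x' : M, x = x' → (Z x : EM) = Z x' := by rintro _ _ rfl; rfl
    exact h3 _ _ (hp.proj_action y k).symm
  · rw [A.form_equivariant, liftField, liftField, form_horizontalLift hp, form_horizontalLift hp,
      map_zero]

theorem isSmoothField_liftField [IsManifold IM ∞ M] (hp : IsPrincipalBundle IM IK K IP p)
    (A : PrincipalConnection IK K IP P) {Z : ∀ x : M, TangentSpace IM x}
    (hZ : IsSmoothField IM Z) : IsSmoothField IP (liftField IM A p Z) := by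
  intro y
  obtain ⟨S, hS, hSZ⟩ := hp.exists_local_lift hZ y
  -- subtract the vertical part from a local lift
  have h1 := hS.sub_section
    (contMDiffAt_verticalField hp.contMDiff_action (A.contMDiffAt_form_apply hS))
  refine h1.congr_of_eventuallyEq ?_
  filter_upwards [hSZ] with z hz
  refine congrArg (TotalSpace.mk' EP z) ?_
  refine eq_of_mfderiv_eq_of_form_eq hp A ?_ ?_
  · rw [liftField, mfderiv_horizontalLift hp, Pi.sub_apply, map_sub, verticalField,
      hp.mfderiv_fundamental, sub_zero, hz]
  · rw [liftField, form_horizontalLift hp, Pi.sub_apply, map_sub, verticalField,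
      A.form_fundamental, sub_self]

end PrincipalBundle

/-! ### Smooth fields through given tangent vectors -/

section SmoothFields

variable {E : Type*} [NormedAddCommGroup E] [NormedSpace ℝ E]
  {H : Type*} [TopologicalSpace H] {I : ModelWithCorners ℝ E H}
  {M : Type*} [TopologicalSpace M] [ChartedSpace H M]

theorem mvfderiv_clm_comp_apply {F F' : Type*} [NormedAddCommGroup F] [NormedSpace ℝ F]
    [NormedAddCommGroup F'] [NormedSpace ℝ F'] (c : F →L[ℝ] F') {f : M → F} {x : M}
    (hf : MDifferentiableAt I 𝓘(ℝ, F) f x) (v : TangentSpace I x) :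
    mvfderiv I (fun z => c (f z)) x v = c (mvfderiv I f x v) := by
  have h := mfderiv_comp_apply (I := I) (I' := 𝓘(ℝ, F)) (I'' := 𝓘(ℝ, F')) (g := c) (f := f) x
    c.mdifferentiableAt hf v
  rw [ContinuousLinearMap.mfderiv_eq] at h
  exact h

variable [IsManifold I ∞ M]

theorem IsSmoothField.mdifferentiableAt {X : ∀ x : M, TangentSpace I x} (hX : IsSmoothField I X)
    (x : M) : MDifferentiableAt I I.tangent (fun z => (⟨z, X z⟩ : TangentBundle I M)) x :=
  ContMDiff.mdifferentiableAt hX (by simp)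

/-- Every tangent vector is the value of a smooth vector field. -/
theorem exists_isSmoothField_eq [FiniteDimensional ℝ E] [T2Space M] (x : M)
    (u : TangentSpace I x) : ∃ Z : ∀ z : M, TangentSpace I z, IsSmoothField I Z ∧ Z x = u := by
  obtain ⟨s, hs, hsu⟩ := FiberBundle.exists_contMDiffOn_extend (k := ∞) I E u
  obtain ⟨ψ, -, hψ⟩ := (SmoothBumpFunction.nhds_basis_tsupport (I := I) x).mem_iff.1
    (interior_mem_nhds.2 hs)
  refine ⟨(ψ : M → ℝ) • FiberBundle.extend E u, ?_, by simp⟩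
  exact ContMDiffOn.smul_section_of_tsupport ψ.contMDiff.contMDiffOn isOpen_interior hψ
    (hsu.mono interior_subset)

end SmoothFields

/-! ### Brackets with horizontal lifts, and curvature -/

section Killing

set_option linter.unusedSectionVars false

variable {EM : Type*} [NormedAddCommGroup EM] [NormedSpace ℝ EM] [FiniteDimensional ℝ EM]
  {HM : Type*} [TopologicalSpace HM] {IM : ModelWithCorners ℝ EM HM}
  {M : Type*} [TopologicalSpace M] [ChartedSpace HM M] [IsManifold IM ∞ M]
  {EK : Type*} [NormedAddCommGroup EK] [NormedSpace ℝ EK] [FiniteDimensional ℝ EK]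
  {HK : Type*} [TopologicalSpace HK] {IK : ModelWithCorners ℝ EK HK}
  {K : Type*} [TopologicalSpace K] [ChartedSpace HK K] [Group K] [LieGroup IK ∞ K]
  {EP : Type*} [NormedAddCommGroup EP] [NormedSpace ℝ EP] [FiniteDimensional ℝ EP]
  {HP : Type*} [TopologicalSpace HP] {IP : ModelWithCorners ℝ EP HP}
  {P : Type*} [TopologicalSpace P] [ChartedSpace HP P] [IsManifold IP ∞ P]
  [MulAction Kᵐᵒᵖ P] {p : P → M}

/-- The horizontal lifts commute with the fundamental fields. -/
theorem mlieBracket_liftField_fundamental (hp : IsPrincipalBundle IM IK K IP p)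
    (A : PrincipalConnection IK K IP P) {Z : ∀ x : M, TangentSpace IM x}
    (hZ : IsSmoothField IM Z) (a : GroupLieAlgebra IK K) (y : P) :
    mlieBracket IP (liftField IM A p Z) (verticalField IK IP fun _ => a) y = 0 := by
  have : CompleteSpace EP := FiniteDimensional.complete ℝ EP
  have : CompleteSpace EK := FiniteDimensional.complete ℝ EK
  exact mlieBracket_fundamental_of_invariant hp.contMDiff_action (isSmoothField_liftField hp A hZ)
    (mfderiv_rightMul_liftField hp A Z) a y

/-- `[ξ^ν, Z̃] = -(∇^A_Z ν)^#`. -/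
theorem mlieBracket_verticalField_liftField (hp : IsPrincipalBundle IM IK K IP p)
    (A : PrincipalConnection IK K IP P) {Z : ∀ x : M, TangentSpace IM x}
    (hZ : IsSmoothField IM Z) {ν : P → GroupLieAlgebra IK K}
    (hν : ContMDiff IP 𝓘(ℝ, EK) (M' := EK) ∞ ν) (y : P) :
    mlieBracket IP (verticalField IK IP ν) (liftField IM A p Z) y =
      -fundamental IK IP y (covDeriv IM A p ν Z y) := by
  have : CompleteSpace EP := FiniteDimensional.complete ℝ EP
  let b := Module.finBasis ℝ EK
  let c (i) : EK →L[ℝ] ℝ := (b.coord i).toContinuousLinearMap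
  let f (i) : P → ℝ := fun z => c i (ν z)
  let e (i) : ∀ z : P, TangentSpace IP z :=
    verticalField (K := K) IK IP fun _ => (b i : EK)
  have hf (i) : ContMDiff IP 𝓘(ℝ, ℝ) ∞ (f i) := (c i).contMDiff.comp hν
  have he (i) : IsSmoothField IP (e i) :=
    isSmoothField_verticalField hp.contMDiff_action contMDiff_const
  have hfe (i) : IsSmoothField IP (f i • e i) := ContMDiff.smul_section (hf i) (he i)
  have hL (L : EK →L[ℝ] EP) (v : EK) : L v = ∑ i, c i v • L (b i) := by
    have hsum : ∑ i, c i v • b i = v := b.sum_repr v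
    conv_lhs => rw [← hsum, map_sum]
    simp only [map_smul]
  -- `ξ^ν` is a combination of fundamental fields, with the coordinates of `ν` as coefficients
  have hν' : verticalField IK IP ν = ∑ i, f i • e i := by
    funext z
    rw [Finset.sum_apply]
    exact hL (fundamental IK IP z) (ν z)
  have hcomm (i) : mlieBracket IP (liftField IM A p Z) (e i) y = 0 :=
    mlieBracket_liftField_fundamental hp A hZ (b i : EK) y
  have hfi (i) : mlieBracket IP (f i • e i) (liftField IM A p Z) y =
      -(c i (covDeriv IM A p ν Z y) • e i y) := by
    rw [mlieBracket_smul_left ((hf i).mdifferentiableAt (by simp)) ((he i).mdifferentiableAt y),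
      mlieBracket_swap_apply, hcomm i, neg_zero, smul_zero,
      add_zero, neg_smul]
    refine congrArg Neg.neg ?_
    refine congrArg (· • e i y) ?_
    exact mvfderiv_clm_comp_apply (c i) (hν.mdifferentiableAt (by simp)) _
  have hind (s : Finset _) : IsSmoothField IP (∑ i ∈ s, f i • e i) ∧
      mlieBracket IP (∑ i ∈ s, f i • e i) (liftField IM A p Z) y =
      ∑ i ∈ s, -(c i (covDeriv IM A p ν Z y) • e i y) := by
    classical
    induction s using Finset.induction_on with
    | empty =>
      refine ⟨contMDiff_zeroSection ℝ (TangentSpace IP : P → Type _), ?_⟩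
      rw [Finset.sum_empty, Finset.sum_empty]
      exact congr($(mlieBracket_zero_left) _)
    | insert a s ha ih =>
      rw [Finset.sum_insert ha, Finset.sum_insert ha]
      refine ⟨ContMDiff.add_section (hfe a) ih.1, ?_⟩
      rw [mlieBracket_add_left ((hfe a).mdifferentiableAt y) (ih.1.mdifferentiableAt y), hfi, ih.2]
  rw [hν', (hind _).2, Finset.sum_neg_distrib]
  refine congrArg Neg.neg ?_
  exact (hL (fundamental IK IP y) (covDeriv IM A p ν Z y)).symm

/-- The curvature is the vertical part of `-[X̃, Z̃]`, because `ω` vanishes on horizontal lifts. -/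
theorem curvature_eq (hp : IsPrincipalBundle IM IK K IP p)
    (A : PrincipalConnection IK K IP P) (X Z : ∀ x : M, TangentSpace IM x) (y : P) :
    curvature IM A p X Z y =
      -A.form y (mlieBracket IP (liftField IM A p X) (liftField IM A p Z) y) := by
  have h0 (Y : ∀ x : M, TangentSpace IM x) (z : P) : A.form z (liftField IM A p Y z) = 0 :=
    form_horizontalLift hp A z _
  have h1 : dirDeriv IK IP (fun _ : P => (0 : GroupLieAlgebra IK K)) y = 0 :=
    congrArg DFunLike.coe (mvfderiv_const (I := IP) (x := y) (0 : EK))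
  have : LieGroup IK (minSmoothness ℝ 3) K := by
    simp only [minSmoothness_of_isRCLikeNormedField]; infer_instance
  have : CompleteSpace EK := FiniteDimensional.complete ℝ EK
  simp only [curvature, PrincipalConnection.curvatureForm, PrincipalConnection.extDerivForm, h0, h1,
    Pi.zero_apply, sub_zero, zero_sub, zero_lie, add_zero]

variable (hp : IsPrincipalBundle IM IK K IP p) (A : PrincipalConnection IK K IP P)
  (g : ContMDiffRiemannianMetric IM ∞ EM (fun x : M => TangentSpace IM x))
  (B : AdInvariantInner IK K) {X : ∀ x : M, TangentSpace IM x} (hX : IsSmoothField IM X)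
  (ν : AdSection IK K IP P)

/-! ### Brackets with `X̃ + ξ^ν` and components of the Lie derivative of the connection metric -/

theorem mdifferentiableAt_metric_apply {N : Type*} [TopologicalSpace N] [ChartedSpace HP N]
    {f : N → M} {U V : ∀ z : N, TangentSpace IM (f z)} {y : N}
    (hU : MDifferentiableAt IP IM.tangent (fun z => (⟨f z, U z⟩ : TangentBundle IM M)) y)
    (hV : MDifferentiableAt IP IM.tangent (fun z => (⟨f z, V z⟩ : TangentBundle IM M)) y) :
    MDifferentiableAt IP 𝓘(ℝ, ℝ) (fun z => g.inner (f z) (U z) (V z)) y := by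
  have hf : MDifferentiableAt IP IM f y := by
    simp only [mdifferentiableAt_totalSpace] at hU
    exact hU.1
  have : MDifferentiableAt IP (IM.prod 𝓘(ℝ, ℝ)) (fun z =>
      TotalSpace.mk' ℝ (E := Bundle.Trivial M ℝ) (f z) (g.inner (f z) (U z) (V z))) y := by
    apply MDifferentiableAt.clm_bundle_apply₂ (F₁ := EM) (F₂ := EM)
    · exact (g.contMDiff.mdifferentiableAt (by simp)).comp y hf
    · exact hU
    · exact hV
  simp only [mdifferentiableAt_totalSpace] at this
  exact this.2

include hp in
theorem mdifferentiableAt_connectionMetric_apply (y : P) (U V : ∀ y : P, TangentSpace IP y)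
    (hU : MDifferentiableAt IP IP.tangent (fun z => (⟨z, U z⟩ : TangentBundle IP P)) y)
    (hV : MDifferentiableAt IP IP.tangent (fun z => (⟨z, V z⟩ : TangentBundle IP P)) y) :
    MDifferentiableAt IP 𝓘(ℝ, ℝ) (fun z => connectionMetric IM A p g B z (U z) (V z)) y := by
  have hT (U : ∀ y : P, TangentSpace IP y)
      (hU : MDifferentiableAt IP IP.tangent (fun z => (⟨z, U z⟩ : TangentBundle IP P)) y) :
      MDifferentiableAt IP IM.tangent
        (fun z => (⟨p z, mfderiv IP IM p z (U z)⟩ : TangentBundle IM M)) y :=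
    ((hp.contMDiff_proj.contMDiff_tangentMap (m := ∞) le_rfl).mdifferentiableAt
      (by simp)).comp y hU
  have h1 := mdifferentiableAt_metric_apply g (hT U hU) (hT V hV)
  have hω := A.contMDiff_form
  have hωU : MDifferentiableAt IP 𝓘(ℝ, EK) (M' := EK) (fun z => A.form z (U z)) y :=
    (hω.mdifferentiableAt (by simp)).comp y hU
  have hωV : MDifferentiableAt IP 𝓘(ℝ, EK) (M' := EK) (fun z => A.form z (V z)) y :=
    (hω.mdifferentiableAt (by simp)).comp y hV
  let B' : EK →L[ℝ] EK →L[ℝ] ℝ := B.inner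
  have h2 : MDifferentiableAt IP 𝓘(ℝ, ℝ) (fun z => B' (A.form z (U z)) (A.form z (V z))) y :=
    (B'.mdifferentiableAt.comp y hωU).clm_apply hωV
  exact h1.add h2

theorem connectionMetric_symm (y : P) (v w : TangentSpace IP y) :
    connectionMetric IM A p g B y v w = connectionMetric IM A p g B y w v := by
  rw [connectionMetric_apply, connectionMetric_apply, g.symm, B.symm]

/-- The vector field `W = X̃ + ξ^ν`. -/
abbrev liftAddVertical (A : PrincipalConnection IK K IP P) (p : P → M)
    (X : ∀ x : M, TangentSpace IM x) (ν : AdSection IK K IP P) (y : P) : TangentSpace IP y :=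
  liftField IM A p X y + verticalField IK IP ν.toFun y

include hp

theorem mfderiv_liftAddVertical (y : P) :
    mfderiv IP IM p y (liftAddVertical A p X ν y) = X (p y) := by
  rw [liftAddVertical, map_add, verticalField, hp.mfderiv_fundamental, add_zero, liftField,
    mfderiv_horizontalLift hp]

include hX

theorem isSmoothField_liftAddVertical : IsSmoothField IP (liftAddVertical A p X ν) :=
  ContMDiff.add_section (isSmoothField_liftField hp A hX)
    (isSmoothField_verticalField hp.contMDiff_action ν.contMDiff_toFun)

theorem mlieBracket_liftAddVertical_fundamental (a : GroupLieAlgebra IK K) (y : P) :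
    mlieBracket IP (liftAddVertical A p X ν) (verticalField IK IP fun _ => a) y = 0 := by
  have : CompleteSpace EP := FiniteDimensional.complete ℝ EP
  have : CompleteSpace EK := FiniteDimensional.complete ℝ EK
  refine mlieBracket_fundamental_of_invariant hp.contMDiff_action
    (isSmoothField_liftAddVertical hp A hX ν) (fun k z => ?_) a y
  rw [liftAddVertical, map_add, mfderiv_rightMul_liftField hp, verticalField,
    mfderiv_rightMul_fundamental hp.contMDiff_action, ← ν.equivariant]
  rfl

theorem mfderiv_mlieBracket_liftAddVertical {Z : ∀ x : M, TangentSpace IM x}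
    (hZ : IsSmoothField IM Z) (y : P) :
    mfderiv IP IM p y (mlieBracket IP (liftAddVertical A p X ν) (liftField IM A p Z) y) =
      mlieBracket IM X Z (p y) := by
  have : CompleteSpace EP := FiniteDimensional.complete ℝ EP
  have : CompleteSpace EM := FiniteDimensional.complete ℝ EM
  exact mfderiv_mlieBracket_of_related hp.contMDiff_proj
    ((isSmoothField_liftAddVertical hp A hX ν).mdifferentiableAt y)
    ((isSmoothField_liftField hp A hZ).mdifferentiableAt y) (hX.mdifferentiableAt _)
    (hZ.mdifferentiableAt _) (mfderiv_liftAddVertical hp A ν)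
    (fun z => mfderiv_horizontalLift hp A z _)

theorem form_mlieBracket_liftAddVertical {Z : ∀ x : M, TangentSpace IM x}
    (hZ : IsSmoothField IM Z) (y : P) :
    A.form y (mlieBracket IP (liftAddVertical A p X ν) (liftField IM A p Z) y) =
      -(curvature IM A p X Z y + covDeriv IM A p ν.toFun Z y) := by
  have : CompleteSpace EP := FiniteDimensional.complete ℝ EP
  have h1 := mlieBracket_add_left (W := liftField IM A p Z)
    ((isSmoothField_liftField hp A hX).mdifferentiableAt y)
    ((isSmoothField_verticalField hp.contMDiff_action ν.contMDiff_toFun).mdifferentiableAt y)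
  rw [mlieBracket_verticalField_liftField hp A hZ ν.contMDiff_toFun] at h1
  have h2 := congrArg (A.form y) h1
  rw [map_add, map_neg, A.form_fundamental] at h2
  rw [curvature_eq hp, neg_add, neg_neg]
  exact h2


/-- On horizontal lifts, `L_W g_A` is the pullback of `L_X g`. -/
theorem lieDerivBilin_liftField_liftField {Z₁ Z₂ : ∀ x : M, TangentSpace IM x}
    (h₁ : IsSmoothField IM Z₁) (h₂ : IsSmoothField IM Z₂) (y : P) :
    lieDerivBilin IP (liftAddVertical A p X ν) (connectionMetric IM A p g B)
      (liftField IM A p Z₁) (liftField IM A p Z₂) y =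
    lieDerivBilin IM X g.inner Z₁ Z₂ (p y) := by
  have hd (Z : ∀ x : M, TangentSpace IM x) (z : P) :
      mfderiv IP IM p z (liftField IM A p Z z) = Z (p z) := mfderiv_horizontalLift hp A z _
  have h0 (Z : ∀ x : M, TangentSpace IM x) (z : P) : A.form z (liftField IM A p Z z) = 0 :=
    form_horizontalLift hp A z _
  have hg : MDifferentiableAt IM 𝓘(ℝ, ℝ) (fun x => g.inner x (Z₁ x) (Z₂ x)) (p y) :=
    mdifferentiableAt_metric_apply g (h₁.mdifferentiableAt _) (h₂.mdifferentiableAt _)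
  have hc := mfderiv_comp_apply (I := IP) (I' := IM) (I'' := 𝓘(ℝ, ℝ))
    (g := fun x => g.inner x (Z₁ x) (Z₂ x)) (f := p) y hg
    (hp.contMDiff_proj.mdifferentiableAt (by simp)) (liftAddVertical A p X ν y)
  rw [mfderiv_liftAddVertical hp] at hc
  simp only [lieDerivBilin, connectionMetric_apply, hd, h0, map_zero, zero_apply, add_zero,
    mfderiv_mlieBracket_liftAddVertical hp A hX ν h₁,
    mfderiv_mlieBracket_liftAddVertical hp A hX ν h₂]
  exact congrArg (fun t : ℝ => t - g.inner (p y) (mlieBracket IM X Z₁ (p y)) (Z₂ (p y)) -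
    g.inner (p y) (Z₁ (p y)) (mlieBracket IM X Z₂ (p y))) hc

/-- The mixed component of `L_W g_A` is `⟪F_A(X, Z) + ∇^A_Z ν, a⟫`. -/
theorem lieDerivBilin_liftField_fundamental {Z : ∀ x : M, TangentSpace IM x}
    (hZ : IsSmoothField IM Z) (a : GroupLieAlgebra IK K) (y : P) :
    lieDerivBilin IP (liftAddVertical A p X ν) (connectionMetric IM A p g B)
      (liftField IM A p Z) (verticalField IK IP fun _ => a) y =
    B.inner (curvature IM A p X Z y + covDeriv IM A p ν.toFun Z y) a := by
  have h0 (z : P) : A.form z (liftField IM A p Z z) = 0 := form_horizontalLift hp A z _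
  have hv (z : P) : mfderiv IP IM p z (verticalField IK IP (fun _ => a) z) = 0 :=
    hp.mfderiv_fundamental z a
  have hf (z : P) : A.form z (verticalField IK IP (fun _ => a) z) = a := A.form_fundamental z a
  simp only [lieDerivBilin, connectionMetric_apply, h0, hv, hf, map_zero, zero_apply, add_zero,
    mlieBracket_liftAddVertical_fundamental hp A hX ν, mvfderiv_const, zero_add, sub_zero,
    form_mlieBracket_liftAddVertical hp A hX ν hZ, map_neg, neg_apply, zero_sub, neg_neg]

/-- The vertical component of `L_W g_A` is zero. -/
theorem lieDerivBilin_fundamental_fundamental (a b : GroupLieAlgebra IK K) (y : P) :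
    lieDerivBilin IP (liftAddVertical A p X ν) (connectionMetric IM A p g B)
      (verticalField IK IP fun _ => a) (verticalField IK IP fun _ => b) y = 0 := by
  have hv (a) (z : P) : mfderiv IP IM p z (verticalField (K := K) IK IP (fun _ => a) z) = 0 :=
    hp.mfderiv_fundamental z a
  have hf (a) (z : P) : A.form z (verticalField IK IP (fun _ => a) z) = a := A.form_fundamental z a
  simp only [lieDerivBilin, connectionMetric_apply, hv, hf, map_zero, zero_apply,
    mlieBracket_liftAddVertical_fundamental hp A hX ν, mvfderiv_const, zero_add, sub_zero]

/-- The Killing equation for `W = X̃ + ξ^ν` only has to be checked on horizontal lifts and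
fundamental fields: `L_W g_A` is tensorial, and the values of these fields span the tangent
spaces. -/
theorem isKilling_of_components [T2Space M]
    (h₁ : ∀ Z₁ Z₂ : ∀ x : M, TangentSpace IM x, IsSmoothField IM Z₁ → IsSmoothField IM Z₂ → ∀ y,
      lieDerivBilin IP (liftAddVertical A p X ν) (connectionMetric IM A p g B)
        (liftField IM A p Z₁) (liftField IM A p Z₂) y = 0)
    (h₂ : ∀ Z : ∀ x : M, TangentSpace IM x, IsSmoothField IM Z →
      ∀ (a : GroupLieAlgebra IK K) (y : P),
      lieDerivBilin IP (liftAddVertical A p X ν) (connectionMetric IM A p g B)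
        (liftField IM A p Z) (verticalField IK IP fun _ => a) y = 0) :
    IsKilling IP (connectionMetric IM A p g B) (liftAddVertical A p X ν) := by
  intro U V hU hV y
  have : CompleteSpace EP := FiniteDimensional.complete ℝ EP
  set L := fun U V =>
    lieDerivBilin IP (liftAddVertical A p X ν) (connectionMetric IM A p g B) U V y with hL
  have hcomm (U V) : L U V = L V U := lieDerivBilin_comm (connectionMetric_symm A g B) _ U V y
  -- a smooth field can be replaced by a sum of a lift and of a fundamental field
  have hdec (U : ∀ z : P, TangentSpace IP z) (hU : IsSmoothField IP U) :
      ∃ Z : ∀ x : M, TangentSpace IM x, IsSmoothField IM Z ∧ ∃ a : GroupLieAlgebra IK K,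
        ∀ V, IsSmoothField IP V →
          L U V = L (liftField IM A p Z) V + L (verticalField IK IP fun _ => a) V := by
    obtain ⟨Z, hZ, hZy⟩ := exists_isSmoothField_eq (p y) (mfderiv IP IM p y (U y))
    refine ⟨Z, hZ, A.form y (U y), fun V hV => ?_⟩
    have hT := tensorialAt_lieDerivBilin_left
      (mdifferentiableAt_connectionMetric_apply hp A g B y) (liftAddVertical A p X ν) V
      (hV.mdifferentiableAt y)
    have hZ' := isSmoothField_liftField hp A hZ
    have hv := isSmoothField_verticalField hp.contMDiff_action
      (contMDiff_const (I := IP) (I' := 𝓘(ℝ, EK)) (M' := EK) (c := A.form y (U y)))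
    rw [← hT.add (hZ'.mdifferentiableAt y) (hv.mdifferentiableAt y)]
    refine hT.pointwise (hU.mdifferentiableAt y)
      (IsSmoothField.mdifferentiableAt (ContMDiff.add_section hZ' hv) y) ?_
    refine eq_of_mfderiv_eq_of_form_eq hp A ?_ ?_
    · rw [Pi.add_apply, map_add, liftField, mfderiv_horizontalLift hp, verticalField,
        hp.mfderiv_fundamental, add_zero, hZy]
    · rw [Pi.add_apply, map_add, liftField, form_horizontalLift hp, verticalField,
        A.form_fundamental, zero_add]
  obtain ⟨Z₁, hZ₁, a, ha⟩ := hdec U hU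
  obtain ⟨Z₂, hZ₂, b, hb⟩ := hdec V hV
  have hv (a : GroupLieAlgebra IK K) : IsSmoothField IP (verticalField IK IP fun _ => a) :=
    isSmoothField_verticalField hp.contMDiff_action contMDiff_const
  change L U V = 0
  rw [ha V hV, hcomm _ V, hcomm _ V, hb _ (isSmoothField_liftField hp A hZ₁), hb _ (hv a),
    hcomm _ (liftField IM A p Z₁), hcomm _ (liftField IM A p Z₁)]
  simp only [hL, h₁ _ _ hZ₁ hZ₂, h₂ _ hZ₁, h₂ _ hZ₂,
    lieDerivBilin_fundamental_fundamental hp A g B hX, add_zero]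

end Killing

end ConnectionMetric

end

theorem mainTheorem2
    {EM : Type*} [NormedAddCommGroup EM] [NormedSpace ℝ EM] [FiniteDimensional ℝ EM]
    {HM : Type*} [TopologicalSpace HM] (IM : ModelWithCorners ℝ EM HM)
    {M : Type*} [TopologicalSpace M] [ChartedSpace HM M] [IsManifold IM ∞ M]
    [BoundarylessManifold IM M] [T2Space M]
    {EK : Type*} [NormedAddCommGroup EK] [NormedSpace ℝ EK] [FiniteDimensional ℝ EK]
    {HK : Type*} [TopologicalSpace HK] (IK : ModelWithCorners ℝ EK HK)
    {K : Type*} [TopologicalSpace K] [ChartedSpace HK K] [Group K] [LieGroup IK ∞ K]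
    [BoundarylessManifold IK K] [T2Space K] [CompactSpace K]
    {EP : Type*} [NormedAddCommGroup EP] [NormedSpace ℝ EP] [FiniteDimensional ℝ EP]
    {HP : Type*} [TopologicalSpace HP] (IP : ModelWithCorners ℝ EP HP)
    {P : Type*} [TopologicalSpace P] [ChartedSpace HP P] [IsManifold IP ∞ P]
    [BoundarylessManifold IP P] [T2Space P] [MulAction Kᵐᵒᵖ P]
    (p : P → M) (hp : IsPrincipalBundle IM IK K IP p)
    (A : PrincipalConnection IK K IP P)
    (g : Bundle.ContMDiffRiemannianMetric IM ∞ EM (fun x : M => TangentSpace IM x))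
    (B : AdInvariantInner IK K)
    (X : ∀ x : M, TangentSpace IM x) (hX : IsSmoothField IM X)
    (ν : AdSection IK K IP P) :
    IsKilling IP (connectionMetric IM A p g B)
        (fun y => liftField IM A p X y + verticalField IK IP ν.toFun y) ↔
      IsKilling IM g.inner X ∧ GeneralizedMomentMapEq IM A p X ν.toFun := by

  constructor
  · intro h
    refine ⟨fun U V hU hV x => ?_, fun Z hZ y => ?_⟩
    · obtain ⟨y, rfl⟩ := hp.surjective x
      rw [← lieDerivBilin_liftField_liftField hp A g B hX ν hU hV y]
      exact h _ _ (isSmoothField_liftField hp A hU) (isSmoothField_liftField hp A hV) y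
    · -- pair `F_A(X, Z) + ∇^A_Z ν` with itself
      by_contra hne
      have hpos := B.pos (curvature IM A p X Z y + covDeriv IM A p ν.toFun Z y)
        (fun h0 => hne (eq_neg_of_add_eq_zero_left h0))
      rw [← lieDerivBilin_liftField_fundamental hp A g B hX ν hZ] at hpos
      exact hpos.ne' (h _ _ (isSmoothField_liftField hp A hZ)
        (isSmoothField_verticalField hp.contMDiff_action contMDiff_const) y)
  · rintro ⟨hK, hF⟩
    refine isKilling_of_components hp A g B hX ν (fun Z₁ Z₂ h₁ h₂ y => ?_) (fun Z hZ a y => ?_)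
    · rw [lieDerivBilin_liftField_liftField hp A g B hX ν h₁ h₂]
      exact hK _ _ h₁ h₂ _
    · rw [lieDerivBilin_liftField_fundamental hp A g B hX ν hZ, hF Z hZ y, neg_add_cancel, map_zero,
        zero_apply]
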